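/- Let $p,q$ be coprime positive integers and let $\mathbb K$ be $\mathbb R$ or $\mathbb C$. For $n\ge 2$ consider the general (not necessarily homogeneous) system $$\dot x=px+P(x,y),\qquad \dot y=-qy+Q(x,y),\qquad P=\sum_{2\le i+j\le n}a_{ij}x^iy^j,\quad Q=\sum_{2\le i+j\le n}b_{ij}x^iy^j,$$ with indeterminate coefficients, and let $R_n=\mathbb K[a_{ij},b_{ij}]$. Saddle values of the system are elements $L_1,L_2,\dots$ of $R_n$ for which there is a formal power series $H=x^qy^p+\text{(terms of total degree greater than }p+q)$ with coefficients in $R_n$ whose derivative along the system is $$\dot H=\sum_{k\ge 1}L_k\,(x^qy^p)^{k+1}.$$ Such sequences exist. For any choice of one, let $I_k=(L_1,\dots,L_k)$ and $I_\infty=(L_1,L_2,\dots)$ be the ideals of $R_n$ generated by the first $k$, respectively all, saddle values, and let $M^I(p,q,n)$ be the smallest $M\ge 0$ such that $I_M=I_\infty$ (it exists by Hilbert's basis theorem). Then, for fixed $p,q$ and all sufficiently large $n$, $$M^I(p,q,n)\ \ge\ \tfrac32\,n^2+O(n),$$ and if $p=1$, then $$M^I(1,q,n)\ \ge\ 2\,n^2+O(n).$$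 Here $O(n)$ stands for a function of $n$ bounded in absolute value by $Cn$ for all large $n$, with $C$ not depending on $n$, nor on the choice of the saddle values. -/

import Mathlib

open Filter Asymptotics

namespace ResonantSaddle

noncomputable section

section Formal

variable {R : Type*} [CommRing R]

/-- The derivative `Ḣ = H_x * (p x + P) + H_y * (-q y + Q)` of a formal power series `H` in
`x = X 0`, `y = X 1` along the vector field `ẋ = p x + P`, `ẏ = -q y + Q`. -/
def lieDeriv (p q : ℕ) (P Q H : MvPowerSeries (Fin 2) R) : MvPowerSeries (Fin 2) R :=
  MvPowerSeries.pderiv R 0 H * ((p : MvPowerSeries (Fin 2) R) * MvPowerSeries.X 0 + P) +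
    MvPowerSeries.pderiv R 1 H * (-(q : MvPowerSeries (Fin 2) R) * MvPowerSeries.X 1 + Q)

/-- The exponent of the monomial `x ^ q * y ^ p`. -/
def resExp (p q : ℕ) : Fin 2 →₀ ℕ := Finsupp.single 0 q + Finsupp.single 1 p

/-- `L 1, L 2, …` is a sequence of saddle values of `ẋ = p x + P`, `ẏ = -q y + Q`: for some formal
series `H = x ^ q * y ^ p + h.o.t.` one has `Ḣ = ∑_{k ≥ 1} L k * (x ^ q * y ^ p) ^ (k + 1)`.
The entry `L 0` plays no role. -/
def IsSaddleValues (p q : ℕ) (P Q : MvPowerSeries (Fin 2) R) (L : ℕ → R) : Prop :=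
  ∃ H : MvPowerSeries (Fin 2) R,
    (∀ m : Fin 2 →₀ ℕ, m.degree ≤ p + q →
      MvPowerSeries.coeff m H = if m = resExp p q then 1 else 0) ∧
    (∀ k : ℕ, 1 ≤ k →
      MvPowerSeries.coeff ((k + 1) • resExp p q) (lieDeriv p q P Q H) = L k) ∧
    (∀ m : Fin 2 →₀ ℕ, (∀ k : ℕ, 1 ≤ k → m ≠ (k + 1) • resExp p q) →
      MvPowerSeries.coeff m (lieDeriv p q P Q H) = 0)

/-- `I_k`, the ideal generated by the first `k` saddle values `L 1, …, L k`. -/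
def saddleIdeal (L : ℕ → R) (k : ℕ) : Ideal R := Ideal.span (L '' Set.Icc 1 k)

/-- `I_∞`, the ideal generated by all the saddle values `L 1, L 2, …`. -/
def saddleIdealTop (L : ℕ → R) : Ideal R := Ideal.span (L '' Set.Ici 1)

/-- The minimal number `M` with `I_M = I_∞`. -/
def idealOrder (L : ℕ → R) : ℕ := sInf {M : ℕ | saddleIdeal L M = saddleIdealTop L}

end Formal

/-- The exponents of the monomials `x ^ i * y ^ j` with `2 ≤ i + j ≤ n`. -/
abbrev NonlinExp (n : ℕ) : Type := {m : Fin 2 →₀ ℕ // 2 ≤ m.degree ∧ m.degree ≤ n}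

/-- The ring of polynomials over `𝕜` in the coefficients of two polynomials `P` and `Q` of degree
`n` without constant and linear terms; `Sum.inl` labels the coefficients of `P`, `Sum.inr` those
of `Q`. -/
abbrev CoeffRing (𝕜 : Type*) [CommRing 𝕜] (n : ℕ) : Type _ :=
  MvPolynomial (NonlinExp n ⊕ NonlinExp n) 𝕜

/-- The general polynomial `P` of degree `n` without constant and linear terms: its coefficients
are indeterminates. -/
def genP (𝕜 : Type*) [CommRing 𝕜] (n : ℕ) : MvPowerSeries (Fin 2) (CoeffRing 𝕜 n) :=
  fun m => if h : 2 ≤ m.degree ∧ m.degree ≤ n then MvPolynomial.X (Sum.inl ⟨m, h⟩) else 0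

/-- The general polynomial `Q` of degree `n` without constant and linear terms. -/
def genQ (𝕜 : Type*) [CommRing 𝕜] (n : ℕ) : MvPowerSeries (Fin 2) (CoeffRing 𝕜 n) :=
  fun m => if h : 2 ≤ m.degree ∧ m.degree ≤ n then MvPolynomial.X (Sum.inr ⟨m, h⟩) else 0

/-! The minimal number `M` exists, and saddle values exist. -/

instance (n : ℕ) : Finite (NonlinExp n) :=
  ((Finsupp.finite_of_degree_le n).subset fun _ h => h.2).to_subtype

theorem exists_saddleIdeal_eq_top {R : Type*} [CommRing R] [IsNoetherianRing R] (L : ℕ → R) :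
    ∃ M : ℕ, saddleIdeal L M = saddleIdealTop L := by
  have mono : Monotone (saddleIdeal L) := fun a b hab =>
    Ideal.span_mono (Set.image_mono (Set.Icc_subset_Icc_right hab))
  obtain ⟨M, hM⟩ := monotone_stabilizes_iff_noetherian.mpr ‹IsNoetherianRing R› ⟨_, mono⟩
  refine ⟨M, le_antisymm
    (Ideal.span_mono (Set.image_mono fun k hk => hk.1)) (Ideal.span_le.mpr ?_)⟩
  rintro _ ⟨k, hk, rfl⟩
  have h1 : saddleIdeal L M = saddleIdeal L (max M k) := hM _ (le_max_left _ _)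
  change L k ∈ saddleIdeal L M
  rw [h1]
  exact Ideal.subset_span ⟨k, ⟨hk, le_max_right _ _⟩, rfl⟩

theorem saddleIdeal_idealOrder {𝕜 : Type*} [Field 𝕜] {n : ℕ} (L : ℕ → CoeffRing 𝕜 n) :
    saddleIdeal L (idealOrder L) = saddleIdealTop L :=
  Nat.sInf_mem (exists_saddleIdeal_eq_top L)

section Existence

variable {R : Type*} [CommRing R]

theorem coeff_pderiv_mul_X (i : Fin 2) (H : MvPowerSeries (Fin 2) R) (m : Fin 2 →₀ ℕ) :
    MvPowerSeries.coeff m (MvPowerSeries.pderiv R i H * MvPowerSeries.X i) =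
      (m i : R) * MvPowerSeries.coeff m H := by
  classical
  rw [MvPowerSeries.X, MvPowerSeries.coeff_mul_monomial]
  split_ifs with h
  · obtain ⟨a, rfl⟩ : ∃ a, m = a + Finsupp.single i 1 := ⟨_, (tsub_add_cancel_of_le h).symm⟩
    simp [MvPowerSeries.coeff_pderiv, mul_comm]
  · have : m i = 0 := by
      by_contra h0
      exact h (Finsupp.single_le_iff.mpr (Nat.one_le_iff_ne_zero.mpr h0))
    simp [this]

theorem coeff_lieDeriv (p q : ℕ) (P Q H : MvPowerSeries (Fin 2) R) (m : Fin 2 →₀ ℕ) :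
    MvPowerSeries.coeff m (lieDeriv p q P Q H) =
      ((p : R) * m 0 - q * m 1) * MvPowerSeries.coeff m H +
        MvPowerSeries.coeff m
          (MvPowerSeries.pderiv R 0 H * P + MvPowerSeries.pderiv R 1 H * Q) := by
  have h : lieDeriv p q P Q H =
      MvPowerSeries.C (p : R) * (MvPowerSeries.pderiv R 0 H * MvPowerSeries.X 0) -
      MvPowerSeries.C (q : R) * (MvPowerSeries.pderiv R 1 H * MvPowerSeries.X 1) +
      (MvPowerSeries.pderiv R 0 H * P + MvPowerSeries.pderiv R 1 H * Q) := by
    simp only [lieDeriv, map_natCast]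
    ring
  rw [h, map_add, map_sub, MvPowerSeries.coeff_C_mul, MvPowerSeries.coeff_C_mul,
    coeff_pderiv_mul_X, coeff_pderiv_mul_X]
  ring

theorem coeff_pderiv_mul_congr (i : Fin 2) {P H H' : MvPowerSeries (Fin 2) R}
    (hP : ∀ m : Fin 2 →₀ ℕ, m.degree < 2 → MvPowerSeries.coeff m P = 0) (m : Fin 2 →₀ ℕ)
    (hH : ∀ a : Fin 2 →₀ ℕ, a.degree < m.degree →
      MvPowerSeries.coeff a H = MvPowerSeries.coeff a H') :
    MvPowerSeries.coeff m (MvPowerSeries.pderiv R i H * P) =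
      MvPowerSeries.coeff m (MvPowerSeries.pderiv R i H' * P) := by
  classical
  rw [MvPowerSeries.coeff_mul, MvPowerSeries.coeff_mul]
  refine Finset.sum_congr rfl fun ab hab => ?_
  rw [Finset.HasAntidiagonal.mem_antidiagonal] at hab
  by_cases hb : ab.2.degree < 2
  · simp [hP _ hb]
  · rw [MvPowerSeries.coeff_pderiv, MvPowerSeries.coeff_pderiv, hH]
    rw [← hab, map_add, map_add, Finsupp.degree_single]
    omega

/-- One step of the computation of the coefficients of `H`, degree by degree. -/
def stepCoeff {K : Type*} [Field K] [Algebra K R] (p q : ℕ) (P Q H : MvPowerSeries (Fin 2) R)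
    (m : Fin 2 →₀ ℕ) : R :=
  if m.degree ≤ p + q then if m = resExp p q then 1 else 0
  else -(algebraMap K R ((p : K) * m 0 - q * m 1)⁻¹ * MvPowerSeries.coeff m
    (MvPowerSeries.pderiv R 0 H * P + MvPowerSeries.pderiv R 1 H * Q))

/-- The coefficients of `H` of degree less than the given number. -/
def truncH {K : Type*} [Field K] [Algebra K R] (p q : ℕ) (P Q : MvPowerSeries (Fin 2) R) :
    ℕ → MvPowerSeries (Fin 2) R
  | 0 => 0
  | N + 1 => fun m => if m.degree = N then
      stepCoeff (K := K) p q P Q (truncH (K := K) p q P Q N) m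
      else truncH (K := K) p q P Q N m

theorem exists_isSaddleValues (K : Type*) [Field K] [CharZero K] [Algebra K R] {p q : ℕ}
    (hp : 0 < p) (hpq : Nat.Coprime p q) {P Q : MvPowerSeries (Fin 2) R}
    (hP : ∀ m : Fin 2 →₀ ℕ, m.degree < 2 → MvPowerSeries.coeff m P = 0)
    (hQ : ∀ m : Fin 2 →₀ ℕ, m.degree < 2 → MvPowerSeries.coeff m Q = 0) :
    ∃ L : ℕ → R, IsSaddleValues p q P Q L := by
  let s := truncH (K := K) p q P Q
  let H : MvPowerSeries (Fin 2) R := fun m => s (m.degree + 1) m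
  have hs : ∀ N (m : Fin 2 →₀ ℕ), m.degree < N →
      MvPowerSeries.coeff m H = MvPowerSeries.coeff m (s N) := by
    intro N m hm
    induction N with
    | zero => omega
    | succ N ih =>
      rcases Nat.lt_succ_iff_lt_or_eq.mp hm with h | h
      · rw [ih h]
        change s N m = s (N + 1) m
        simp [s, truncH, h.ne]
      · subst h
        rfl
  have hG : ∀ m : Fin 2 →₀ ℕ, ∀ H' : MvPowerSeries (Fin 2) R,
      (∀ a : Fin 2 →₀ ℕ, a.degree < m.degree →
        MvPowerSeries.coeff a H = MvPowerSeries.coeff a H') →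
      MvPowerSeries.coeff m (MvPowerSeries.pderiv R 0 H * P + MvPowerSeries.pderiv R 1 H * Q) =
      MvPowerSeries.coeff m
        (MvPowerSeries.pderiv R 0 H' * P + MvPowerSeries.pderiv R 1 H' * Q) := by
    intro m H' h
    rw [map_add, map_add, coeff_pderiv_mul_congr 0 hP m h, coeff_pderiv_mul_congr 1 hQ m h]
  have hrec : ∀ m : Fin 2 →₀ ℕ,
      MvPowerSeries.coeff m H = stepCoeff (K := K) p q P Q H m := by
    intro m
    have h1 : MvPowerSeries.coeff m H = stepCoeff (K := K) p q P Q (s m.degree) m := by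
      change s (m.degree + 1) m = _
      simp [s, truncH]
    rw [h1, stepCoeff, stepCoeff, hG m _ (hs m.degree)]
  have hlow : ∀ m : Fin 2 →₀ ℕ, m.degree ≤ p + q →
      MvPowerSeries.coeff m H = if m = resExp p q then 1 else 0 := by
    intro m hm
    rw [hrec, stepCoeff, if_pos hm]
  have hdeg : (resExp p q).degree = p + q := by
    simp [resExp, add_comm]
  refine ⟨fun k => MvPowerSeries.coeff ((k + 1) • resExp p q) (lieDeriv p q P Q H), H, hlow,
    fun k _ => rfl, fun m hm => ?_⟩
  rw [coeff_lieDeriv]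
  by_cases hd : m.degree ≤ p + q
  · rw [hG m 0, hlow m hd]
    · split_ifs with h
      · subst h
        simp [resExp, mul_comm]
      · simp
    · intro a ha
      rw [hlow a (by omega), if_neg, map_zero]
      rintro rfl
      omega
  · by_cases hres : p * m 0 = q * m 1
    · exfalso
      obtain ⟨c, hc⟩ : p ∣ m 1 := hpq.dvd_of_dvd_mul_left (hres ▸ dvd_mul_right p (m 0))
      have h0 : m 0 = q * c := by
        rw [hc] at hres
        exact Nat.eq_of_mul_eq_mul_left hp (by rw [hres]; ring)
      have hm2 : m = c • resExp p q := by
        ext i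
        fin_cases i
        · simp [resExp, h0, mul_comm]
        · simp [resExp, hc, mul_comm]
      have hc2 : 2 ≤ c := by
        by_contra hlt
        apply hd
        rw [hm2, map_nsmul, hdeg, smul_eq_mul]
        nlinarith [show c ≤ 1 by omega]
      exact hm (c - 1) (by omega) (by rw [hm2]; congr 1; omega)
    · have hne : (p : K) * m 0 - q * m 1 ≠ 0 := by
        rw [sub_ne_zero]
        exact_mod_cast hres
      have hcast : (p : R) * m 0 - q * m 1 = algebraMap K R ((p : K) * m 0 - q * m 1) := by
        simp
      rw [hrec, stepCoeff, if_neg hd, hcast, mul_neg, ← mul_assoc, ← map_mul,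
        mul_inv_cancel₀ hne, map_one, one_mul, neg_add_cancel]

theorem exists_isSaddleValues_gen (𝕜 : Type*) [Field 𝕜] [CharZero 𝕜] {p q : ℕ} (hp : 0 < p)
    (hpq : Nat.Coprime p q) (n : ℕ) :
    ∃ L : ℕ → CoeffRing 𝕜 n, IsSaddleValues p q (genP 𝕜 n) (genQ 𝕜 n) L :=
  exists_isSaddleValues 𝕜 hp hpq
    (fun _ hm => dif_neg fun h => absurd h.1 (by omega))
    (fun _ hm => dif_neg fun h => absurd h.1 (by omega))

end Existence

end

end ResonantSaddle

namespace ResonantSaddle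

noncomputable section

/-! ### Specialization of the coefficients. -/

section Ideal

variable {R S : Type*} [CommRing R] [CommRing S]

/-! A ring homomorphism that kills `L k` for `1 ≤ k < J` but not `L J` shows `J ≤ idealOrder L`:
otherwise its kernel would contain `I_∞`. So it suffices to exhibit one system, here over the dual
numbers, whose first nonzero saddle value comes late.

Write B = x^N + y^N'. The unperturbed system has the first integral Φ = x^q y^p (1 + B)^s, so its
saddle values vanish. Under the perturbation ε x^v · x ∂/∂x the first nonzero saddle value is ε
times the first nonzero `melnikov` number (`saddleValues_dual`). By `mul_melnikov`, that number is
governed by the coefficient of (x^q y^p)^k in x^v (1 + B)^(-sk-1).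

Take v = (N - tq, N' - tp). Under the coprimality assumptions only k ≡ -t mod NN' can contribute
(`eq_of_resonance`). The first candidate j = NN' - t is killed by s = -2/j: the exponent becomes 1,
and 1 + B has no term that far out. At the second, J = 2NN' - t, the exponent is 3 + 2t/j, not a
natural number, and the coefficient survives. Hence `J ≤ idealOrder L` (`le_idealOrder_gen`).

With N and N' equal to n + O(1) and t = O(n), chosen large enough that x^v · x has degree at most n,
this gives 2n² + O(n) for all coprime p, q. Both bounds follow. -/

theorem le_idealOrder_of_ringHom {L : ℕ → R} (hL : saddleIdeal L (idealOrder L) = saddleIdealTop L)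
    (f : R →+* S) {N : ℕ} (hN : 1 ≤ N) (h0 : ∀ k, 1 ≤ k → k < N → f (L k) = 0)
    (h1 : f (L N) ≠ 0) : N ≤ idealOrder L := by
  by_contra! hlt
  have hle : saddleIdealTop L ≤ RingHom.ker f := by
    rw [← hL, saddleIdeal, Ideal.span_le]
    rintro _ ⟨k, hk, rfl⟩
    exact h0 k hk.1 (hk.2.trans_lt hlt)
  exact h1 (hle (Ideal.subset_span ⟨N, hN, rfl⟩))

theorem map_pderiv (f : R →+* S) (i : Fin 2) (H : MvPowerSeries (Fin 2) R) :
    MvPowerSeries.map f (MvPowerSeries.pderiv R i H) =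
      MvPowerSeries.pderiv S i (MvPowerSeries.map f H) := by
  ext m
  simp [MvPowerSeries.coeff_pderiv]

theorem map_lieDeriv (f : R →+* S) (p q : ℕ) (P Q H : MvPowerSeries (Fin 2) R) :
    MvPowerSeries.map f (lieDeriv p q P Q H) =
      lieDeriv p q (MvPowerSeries.map f P) (MvPowerSeries.map f Q) (MvPowerSeries.map f H) := by
  simp [lieDeriv, map_pderiv]

/-- The defining conditions are identities between coefficients, so they survive base change. This
is why every choice of saddle values is covered at once. -/
theorem IsSaddleValues.map {p q : ℕ} {P Q : MvPowerSeries (Fin 2) R} {L : ℕ → R}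
    (h : IsSaddleValues p q P Q L) (f : R →+* S) :
    IsSaddleValues p q (MvPowerSeries.map f P) (MvPowerSeries.map f Q) (fun k => f (L k)) := by
  obtain ⟨H, h1, h2, h3⟩ := h
  refine ⟨MvPowerSeries.map f H, fun m hm => ?_, fun k hk => ?_, fun m hm => ?_⟩
  · rw [MvPowerSeries.coeff_map, h1 m hm]
    split_ifs <;> simp
  · rw [← map_lieDeriv, MvPowerSeries.coeff_map, h2 k hk]
  · rw [← map_lieDeriv, MvPowerSeries.coeff_map, h3 m hm, map_zero]

theorem exists_map_gen {𝕜 : Type*} [Field 𝕜] [Algebra 𝕜 S] {n : ℕ} {P Q : MvPowerSeries (Fin 2) S}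
    (hP : ∀ m : Fin 2 →₀ ℕ, ¬(2 ≤ m.degree ∧ m.degree ≤ n) → MvPowerSeries.coeff m P = 0)
    (hQ : ∀ m : Fin 2 →₀ ℕ, ¬(2 ≤ m.degree ∧ m.degree ≤ n) → MvPowerSeries.coeff m Q = 0) :
    ∃ f : CoeffRing 𝕜 n →+* S,
      MvPowerSeries.map f (genP 𝕜 n) = P ∧ MvPowerSeries.map f (genQ 𝕜 n) = Q := by
  refine ⟨(MvPolynomial.aeval (Sum.elim (fun m : NonlinExp n => MvPowerSeries.coeff m.1 P)
    (fun m : NonlinExp n => MvPowerSeries.coeff m.1 Q)) : CoeffRing 𝕜 n →ₐ[𝕜] S), ?_, ?_⟩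
  · ext m
    rw [MvPowerSeries.coeff_map, MvPowerSeries.coeff_apply, genP]
    split_ifs with h
    · simp
    · rw [map_zero, hP m h]
  · ext m
    rw [MvPowerSeries.coeff_map, MvPowerSeries.coeff_apply, genQ]
    split_ifs with h
    · simp
    · rw [map_zero, hQ m h]

end Ideal

/-! ### First-order perturbation over the dual numbers. -/

section Dual

variable {K : Type*} [CommRing K]

/-- The coefficient of `ε` of a power series over the dual numbers. -/
def sndSeries (F : MvPowerSeries (Fin 2) (DualNumber K)) : MvPowerSeries (Fin 2) K :=
  fun m => TrivSqZeroExt.snd (MvPowerSeries.coeff m F)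

/-- The constant part of a power series over the dual numbers. -/
def fstSeries (F : MvPowerSeries (Fin 2) (DualNumber K)) : MvPowerSeries (Fin 2) K :=
  MvPowerSeries.map (TrivSqZeroExt.fstHom K K K).toRingHom F

theorem coeff_sndSeries (F : MvPowerSeries (Fin 2) (DualNumber K)) (m : Fin 2 →₀ ℕ) :
    MvPowerSeries.coeff m (sndSeries F) = TrivSqZeroExt.snd (MvPowerSeries.coeff m F) := rfl

theorem coeff_fstSeries (F : MvPowerSeries (Fin 2) (DualNumber K)) (m : Fin 2 →₀ ℕ) :
    MvPowerSeries.coeff m (fstSeries F) = TrivSqZeroExt.fst (MvPowerSeries.coeff m F) := rfl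

theorem sndSeries_add (F G : MvPowerSeries (Fin 2) (DualNumber K)) :
    sndSeries (F + G) = sndSeries F + sndSeries G := by
  ext m
  simp [coeff_sndSeries]

theorem sndSeries_mul (F G : MvPowerSeries (Fin 2) (DualNumber K)) :
    sndSeries (F * G) = fstSeries F * sndSeries G + sndSeries F * fstSeries G := by
  classical
  ext m
  simp only [coeff_sndSeries, map_add, MvPowerSeries.coeff_mul, TrivSqZeroExt.snd_sum,
    coeff_fstSeries, ← Finset.sum_add_distrib]
  refine Finset.sum_congr rfl fun ab _ => ?_
  simp [TrivSqZeroExt.snd_mul, mul_comm]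

theorem sndSeries_map (F : MvPowerSeries (Fin 2) K) :
    sndSeries (MvPowerSeries.map (TrivSqZeroExt.inlHom K K) F) = 0 := by
  ext m
  simp [coeff_sndSeries]

theorem fstSeries_map (F : MvPowerSeries (Fin 2) K) :
    fstSeries (MvPowerSeries.map (TrivSqZeroExt.inlHom K K) F) = F := by
  ext m
  simp [coeff_fstSeries]

theorem sndSeries_pderiv (i : Fin 2) (F : MvPowerSeries (Fin 2) (DualNumber K)) :
    sndSeries (MvPowerSeries.pderiv _ i F) = MvPowerSeries.pderiv _ i (sndSeries F) := by
  ext m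
  simp [coeff_sndSeries, MvPowerSeries.coeff_pderiv, mul_comm]

/-- The series with constant part `F` and `ε`-part `G`. -/
def dualSeries (F G : MvPowerSeries (Fin 2) K) : MvPowerSeries (Fin 2) (DualNumber K) :=
  fun m => (MvPowerSeries.coeff m F, MvPowerSeries.coeff m G)

theorem coeff_dualSeries_eq_zero {F G : MvPowerSeries (Fin 2) K} {m : Fin 2 →₀ ℕ}
    (hF : MvPowerSeries.coeff m F = 0) (hG : MvPowerSeries.coeff m G = 0) :
    MvPowerSeries.coeff m (dualSeries F G) = 0 :=
  Prod.ext hF hG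

theorem fstSeries_dualSeries (F G : MvPowerSeries (Fin 2) K) :
    fstSeries (dualSeries F G) = F := rfl

theorem sndSeries_dualSeries (F G : MvPowerSeries (Fin 2) K) :
    sndSeries (dualSeries F G) = G := rfl

theorem fstSeries_lieDeriv (p q : ℕ) (P Q H : MvPowerSeries (Fin 2) (DualNumber K)) :
    fstSeries (lieDeriv p q P Q H) = lieDeriv p q (fstSeries P) (fstSeries Q) (fstSeries H) :=
  map_lieDeriv _ _ _ _ _ _

/-- The product rule for the ε-part; the linear part of the field is constant in ε and so
contributes no term of its own. -/
theorem sndSeries_lieDeriv (p q : ℕ) (P Q H : MvPowerSeries (Fin 2) (DualNumber K)) :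
    sndSeries (lieDeriv p q P Q H) =
      lieDeriv p q (fstSeries P) (fstSeries Q) (sndSeries H) +
        (MvPowerSeries.pderiv K 0 (fstSeries H) * sndSeries P +
          MvPowerSeries.pderiv K 1 (fstSeries H) * sndSeries Q) := by
  have h1 : ((p : MvPowerSeries (Fin 2) (DualNumber K)) * MvPowerSeries.X 0) =
      MvPowerSeries.map (TrivSqZeroExt.inlHom K K) ((p : MvPowerSeries (Fin 2) K) * MvPowerSeries.X 0) := by
    simp
  have h2 : (-(q : MvPowerSeries (Fin 2) (DualNumber K)) * MvPowerSeries.X 1) =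
      MvPowerSeries.map (TrivSqZeroExt.inlHom K K) (-(q : MvPowerSeries (Fin 2) K) * MvPowerSeries.X 1) := by
    simp
  have h3 : ∀ F G : MvPowerSeries (Fin 2) (DualNumber K),
      fstSeries (F + G) = fstSeries F + fstSeries G := fun F G => map_add _ F G
  have h4 : ∀ i, fstSeries (MvPowerSeries.pderiv _ i H) =
      MvPowerSeries.pderiv _ i (fstSeries H) := fun i => map_pderiv _ i H
  simp only [lieDeriv, h1, h2, sndSeries_add, sndSeries_mul, sndSeries_map, fstSeries_map,
    sndSeries_pderiv, h3, h4]
  ring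

end Dual

/-! ### Euler operators and the chain rule. -/

section Chain

variable {R : Type*} [CommRing R]

/-- The Euler operators `x ∂/∂x` and `y ∂/∂y`. -/
def euler (i : Fin 2) : Derivation R (MvPowerSeries (Fin 2) R) (MvPowerSeries (Fin 2) R) :=
  (MvPowerSeries.X i : MvPowerSeries (Fin 2) R) • MvPowerSeries.pderiv R i

theorem euler_apply (i : Fin 2) (F : MvPowerSeries (Fin 2) R) :
    euler i F = MvPowerSeries.X i * MvPowerSeries.pderiv R i F := rfl

theorem coeff_euler (i : Fin 2) (F : MvPowerSeries (Fin 2) R) (m : Fin 2 →₀ ℕ) :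
    MvPowerSeries.coeff m (euler i F) = (m i : R) * MvPowerSeries.coeff m F := by
  rw [euler_apply, mul_comm, coeff_pderiv_mul_X]

theorem euler_comm (i j : Fin 2) (F : MvPowerSeries (Fin 2) R) :
    euler i (euler j F) = euler j (euler i F) := by
  ext m
  simp only [coeff_euler]
  ring

theorem euler_mul (i : Fin 2) (F G : MvPowerSeries (Fin 2) R) :
    euler i (F * G) = F * euler i G + euler i F * G := by
  rw [Derivation.leibniz, smul_eq_mul, smul_eq_mul, mul_comm G]

theorem euler_monomial (i : Fin 2) (m : Fin 2 →₀ ℕ) (a : R) :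
    euler i (MvPowerSeries.monomial m a) = MvPowerSeries.C (m i : R) * MvPowerSeries.monomial m a := by
  classical
  ext d
  rw [coeff_euler, MvPowerSeries.coeff_C_mul, MvPowerSeries.coeff_monomial]
  split_ifs with h
  · rw [h]
  · simp

theorem coeff_mul_eq_zero_of_degree_lt {d : ℕ} {F G : MvPowerSeries (Fin 2) R}
    (hF : ∀ m : Fin 2 →₀ ℕ, m.degree < d → MvPowerSeries.coeff m F = 0) (m : Fin 2 →₀ ℕ)
    (hm : m.degree < d) : MvPowerSeries.coeff m (F * G) = 0 := by
  classical
  rw [MvPowerSeries.coeff_mul]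
  refine Finset.sum_eq_zero fun ab hab => ?_
  rw [Finset.HasAntidiagonal.mem_antidiagonal] at hab
  rw [hF ab.1, zero_mul]
  rw [← hab, map_add] at hm
  omega

theorem coeff_mul_eq_zero_of_degree_lt_succ {d : ℕ} {z F : MvPowerSeries (Fin 2) R}
    (hz : MvPowerSeries.constantCoeff z = 0)
    (hF : ∀ m : Fin 2 →₀ ℕ, m.degree < d → MvPowerSeries.coeff m F = 0) (m : Fin 2 →₀ ℕ)
    (hm : m.degree < d + 1) : MvPowerSeries.coeff m (z * F) = 0 := by
  classical
  rw [MvPowerSeries.coeff_mul]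
  refine Finset.sum_eq_zero fun ab hab => ?_
  rw [Finset.HasAntidiagonal.mem_antidiagonal] at hab
  by_cases h : ab.1 = 0
  · rw [h, MvPowerSeries.coeff_zero_eq_constantCoeff_apply, hz, zero_mul]
  · rw [hF ab.2, mul_zero]
    have := (Finsupp.degree_eq_zero_iff ab.1).not.mpr h
    rw [← hab, map_add] at hm
    omega

/-- Writing f = X g + a, the defect of the chain rule for f is z times the defect for g. Since z has
no constant term, each step raises the order of vanishing by one. -/
theorem euler_subst (i : Fin 2) (f : PowerSeries R) {z : MvPowerSeries (Fin 2) R}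
    (hz : MvPowerSeries.constantCoeff z = 0) :
    euler i (f.subst z) = (PowerSeries.derivative R f).subst z * euler i z := by
  have hs : PowerSeries.HasSubst z := PowerSeries.HasSubst.of_constantCoeff_zero hz
  have key : ∀ d : ℕ, ∀ f : PowerSeries R, ∀ m : Fin 2 →₀ ℕ, m.degree < d →
      MvPowerSeries.coeff m
        (euler i (f.subst z) - (PowerSeries.derivative R f).subst z * euler i z) = 0 := by
    intro d
    induction d with
    | zero => intro f m hm; omega
    | succ d ih =>
      intro f m hm
      obtain ⟨g, a, rfl⟩ : ∃ g : PowerSeries R, ∃ a : R, f = PowerSeries.X * g + PowerSeries.C a :=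
        ⟨_, _, PowerSeries.eq_X_mul_shift_add_const f⟩
      have h1 : (PowerSeries.X * g + PowerSeries.C a).subst z =
          z * g.subst z + MvPowerSeries.C a := by
        rw [PowerSeries.subst_add hs, PowerSeries.subst_mul hs, PowerSeries.subst_X hs,
          PowerSeries.subst_C]
      have h2 : (PowerSeries.derivative R (PowerSeries.X * g + PowerSeries.C a)).subst z =
          z * (PowerSeries.derivative R g).subst z + g.subst z := by
        rw [map_add, PowerSeries.derivative_C, add_zero, Derivation.leibniz,
          PowerSeries.derivative_X, smul_eq_mul, smul_eq_mul, mul_one,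
          PowerSeries.subst_add hs, PowerSeries.subst_mul hs, PowerSeries.subst_X hs]
      have h3 : euler i (MvPowerSeries.C a : MvPowerSeries (Fin 2) R) = 0 := by
        rw [euler_apply, MvPowerSeries.pderiv_C, mul_zero]
      have h4 : euler i ((PowerSeries.X * g + PowerSeries.C a).subst z) -
          (PowerSeries.derivative R (PowerSeries.X * g + PowerSeries.C a)).subst z * euler i z =
          z * (euler i (g.subst z) - (PowerSeries.derivative R g).subst z * euler i z) := by
        rw [h1, h2, map_add, h3, euler_mul]
        ring
      rw [h4]
      exact coeff_mul_eq_zero_of_degree_lt_succ hz (ih g) m hm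
  rw [← sub_eq_zero]
  ext m
  rw [key (m.degree + 1) f m (Nat.lt_succ_self _), map_zero]

end Chain

/-! ### Generalized binomial coefficients. -/

section Binomial

variable {K : Type*} [Field K] [CharZero K]

theorem derivative_binomialSeries (c : K) :
    PowerSeries.derivative K (PowerSeries.binomialSeries K c) =
      PowerSeries.C c * PowerSeries.binomialSeries K (c - 1) := by
  ext n
  rw [PowerSeries.coeff_derivative, PowerSeries.coeff_C_mul, PowerSeries.binomialSeries_coeff,
    PowerSeries.binomialSeries_coeff]
  have h := Ring.choose_smul_choose c (show 1 ≤ n + 1 by omega)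
  simp only [Nat.choose_one_right, Ring.choose_one_right, Nat.add_sub_cancel, nsmul_eq_mul,
    Nat.cast_one] at h
  simp only [smul_eq_mul, mul_one]
  rw [← h]
  push_cast
  ring

/-- Up to e!, the coefficient is c(c - 1)⋯(c - e + 1). -/
theorem choose_ne_zero {c : K} {e : ℕ} (h : ∀ i : ℕ, i < e → c ≠ i) : Ring.choose c e ≠ 0 := by
  induction e with
  | zero => simp
  | succ e ih =>
    have h1 := Ring.choose_smul_choose c (show e ≤ e + 1 by omega)
    simp only [Nat.choose_succ_self_right, Nat.add_sub_cancel_left, Ring.choose_one_right,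
      nsmul_eq_mul] at h1
    intro h0
    rw [h0, mul_zero] at h1
    rcases mul_eq_zero.mp h1.symm with h2 | h2
    · exact ih (fun i hi => h i (by omega)) h2
    · exact h e (by omega) (sub_eq_zero.mp h2)

end Binomial

/-! ### Powers of 1 + x^N + y^N' and their lattice support. -/

section System

open MvPowerSeries

variable {K : Type*} [Field K]

/-- The exponent of `x ^ a * y ^ b`. -/
abbrev expo (a b : ℕ) : Fin 2 →₀ ℕ := Finsupp.single 0 a + Finsupp.single 1 b

/-- The polynomial `x ^ N + y ^ N'`. -/
def binom (K : Type*) [Field K] (N N' : ℕ) : MvPowerSeries (Fin 2) K :=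
  monomial (expo N 0) 1 + monomial (expo 0 N') 1

theorem expo_eq (m : Fin 2 →₀ ℕ) : expo (m 0) (m 1) = m := by
  ext i
  fin_cases i <;> simp [expo]

theorem expo_inj {a b c d : ℕ} : expo a b = expo c d ↔ a = c ∧ b = d := by
  refine ⟨fun h => ⟨?_, ?_⟩, fun h => by rw [h.1, h.2]⟩
  · simpa [expo] using DFunLike.congr_fun h 0
  · simpa [expo] using DFunLike.congr_fun h 1

theorem expo_zero_apply (a b : ℕ) : expo a b 0 = a := by simp [expo]

theorem expo_one_apply (a b : ℕ) : expo a b 1 = b := by simp [expo]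

theorem degree_expo (a b : ℕ) : (expo a b).degree = a + b := by simp [expo]

theorem smul_resExp (p q k : ℕ) : k • resExp p q = expo (k * q) (k * p) := by
  simp [resExp, expo]

theorem euler_C_mul (i : Fin 2) (b : K) (F : MvPowerSeries (Fin 2) K) :
    euler i (C b * F) = C b * euler i F := by
  ext m
  rw [coeff_euler, coeff_C_mul, coeff_C_mul, coeff_euler]
  ring

theorem coeff_monomial_mul_of_degree_lt {d m : Fin 2 →₀ ℕ} (h : m.degree < d.degree)
    (F : MvPowerSeries (Fin 2) K) : coeff m (monomial d 1 * F) = 0 := by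
  classical
  rw [coeff_monomial_mul, if_neg]
  intro hle
  obtain ⟨e, rfl⟩ := exists_add_of_le hle
  rw [map_add] at h
  omega

variable {N N' : ℕ}

theorem binom_pow (d : ℕ) : binom K N N' ^ d =
    ∑ m ∈ Finset.range (d + 1), monomial (expo (m * N) ((d - m) * N')) (d.choose m : K) := by
  rw [binom, add_pow]
  refine Finset.sum_congr rfl fun m _ => ?_
  rw [monomial_pow, monomial_pow, monomial_mul_monomial, one_pow, one_pow, one_mul]
  have h1 : m • expo N 0 + (d - m) • expo 0 N' = expo (m * N) ((d - m) * N') := by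
    simp [expo]
  have h2 : ((d.choose m : ℕ) : MvPowerSeries (Fin 2) K) = monomial 0 (d.choose m : K) := by
    rw [monomial_zero_eq_C_apply, map_natCast]
  rw [h1, h2, monomial_mul_monomial, add_zero, one_mul]

/-- All exponents of `F` lie in the lattice `N ℤ × N' ℤ`. -/
def LatticeSupported (N N' : ℕ) (F : MvPowerSeries (Fin 2) K) : Prop :=
  ∀ m : Fin 2 →₀ ℕ, coeff m F ≠ 0 → N ∣ m 0 ∧ N' ∣ m 1

theorem LatticeSupported.mul {F G : MvPowerSeries (Fin 2) K} (hF : LatticeSupported N N' F)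
    (hG : LatticeSupported N N' G) : LatticeSupported N N' (F * G) := by
  classical
  intro m hm
  rw [coeff_mul] at hm
  obtain ⟨ab, hab, h⟩ := Finset.exists_ne_zero_of_sum_ne_zero hm
  rw [Finset.HasAntidiagonal.mem_antidiagonal] at hab
  have h1 := hF _ (left_ne_zero_of_mul h)
  have h2 := hG _ (right_ne_zero_of_mul h)
  rw [← hab]
  exact ⟨dvd_add h1.1 h2.1, dvd_add h1.2 h2.2⟩

theorem LatticeSupported.add {F G : MvPowerSeries (Fin 2) K} (hF : LatticeSupported N N' F)
    (hG : LatticeSupported N N' G) : LatticeSupported N N' (F + G) := by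
  intro m hm
  by_cases h : coeff m F = 0
  · exact hG m (by rwa [map_add, h, zero_add] at hm)
  · exact hF m h

theorem LatticeSupported.euler {F : MvPowerSeries (Fin 2) K} (hF : LatticeSupported N N' F)
    (i : Fin 2) : LatticeSupported N N' (euler i F) := by
  intro m hm
  rw [coeff_euler] at hm
  exact hF m (right_ne_zero_of_mul hm)

theorem LatticeSupported.of_monomial {a b : ℕ} (ha : N ∣ a) (hb : N' ∣ b) (c : K) :
    LatticeSupported N N' (monomial (expo a b) c) := by
  intro m hm
  rw [eq_of_coeff_monomial_ne_zero hm, expo_zero_apply, expo_one_apply]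
  exact ⟨ha, hb⟩

theorem latticeSupported_C (c : K) : LatticeSupported N N' (C c : MvPowerSeries (Fin 2) K) := by
  have h := LatticeSupported.of_monomial (dvd_zero N) (dvd_zero N') c
  have h0 : expo 0 0 = 0 := by simp [expo]
  rwa [h0, monomial_zero_eq_C_apply] at h

theorem latticeSupported_binom : LatticeSupported N N' (binom K N N') :=
  (LatticeSupported.of_monomial dvd_rfl (dvd_zero _) 1).add
    (LatticeSupported.of_monomial (dvd_zero _) dvd_rfl 1)

theorem degree_of_coeff_binom_ne_zero {d : Fin 2 →₀ ℕ} (h : coeff d (binom K N N') ≠ 0) :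
    d.degree = N ∨ d.degree = N' := by
  rw [binom, map_add] at h
  by_cases h1 : coeff d (monomial (expo N 0) (1 : K)) = 0
  · rw [h1, zero_add] at h
    right
    rw [eq_of_coeff_monomial_ne_zero h, degree_expo, zero_add]
  · left
    rw [eq_of_coeff_monomial_ne_zero h1, degree_expo, add_zero]

variable [NeZero N] [NeZero N']

theorem constantCoeff_binom : constantCoeff (binom K N N') = 0 := by
  have h1 : (0 : Fin 2 →₀ ℕ) ≠ expo N 0 := fun h => NeZero.ne N (by
    simpa [expo] using (DFunLike.congr_fun h 0).symm)
  have h2 : (0 : Fin 2 →₀ ℕ) ≠ expo 0 N' := fun h => NeZero.ne N' (by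
    simpa [expo] using (DFunLike.congr_fun h 1).symm)
  rw [← coeff_zero_eq_constantCoeff_apply, binom, map_add, coeff_monomial_ne h1,
    coeff_monomial_ne h2, add_zero]

theorem hasSubst_binom : PowerSeries.HasSubst (binom K N N') :=
  PowerSeries.HasSubst.of_constantCoeff_zero constantCoeff_binom

variable [CharZero K]

/-- The power `(1 + x ^ N + y ^ N') ^ c`. -/
def binomPow (N N' : ℕ) (c : K) : MvPowerSeries (Fin 2) K :=
  (PowerSeries.binomialSeries K c).subst (binom K N N')

theorem binomPow_add (c d : K) :
    binomPow N N' (c + d) = binomPow N N' c * binomPow N N' d := by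
  rw [binomPow, PowerSeries.binomialSeries_add, PowerSeries.subst_mul hasSubst_binom]
  rfl

theorem binomPow_zero (M M' : ℕ) : binomPow M M' (0 : K) = 1 := by
  rw [binomPow, PowerSeries.binomialSeries_zero, ← map_one (PowerSeries.C (R := K)),
    PowerSeries.subst_C, map_one]

theorem binomPow_one : binomPow N N' (1 : K) = 1 + binom K N N' := by
  have h := PowerSeries.binomialSeries_nat (R := K) (A := K) 1
  rw [Nat.cast_one, pow_one] at h
  rw [binomPow, h, PowerSeries.subst_add hasSubst_binom, PowerSeries.subst_X hasSubst_binom,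
    ← map_one (PowerSeries.C (R := K)), PowerSeries.subst_C, map_one]

theorem binomPow_mul_binomPow {a b c : K} (h : a + b = c) :
    binomPow N N' a * binomPow N N' b = binomPow N N' c := by
  rw [← binomPow_add, h]

theorem one_add_mul_binomPow {a b : K} (h : a + 1 = b) :
    (1 + binom K N N') * binomPow N N' a = binomPow N N' b := by
  rw [← binomPow_one, binomPow_mul_binomPow (by rw [add_comm, h])]

theorem euler_binomPow (i : Fin 2) (c : K) :
    euler i (binomPow N N' c) = C c * binomPow N N' (c - 1) * euler i (binom K N N') := by
  rw [binomPow, euler_subst i _ constantCoeff_binom, derivative_binomialSeries,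
    PowerSeries.subst_mul hasSubst_binom, PowerSeries.subst_C]
  rfl

theorem constantCoeff_binomPow (c : K) : coeff 0 (binomPow N N' c) = 1 := by
  rw [binomPow, PowerSeries.coeff_subst hasSubst_binom, finsum_eq_single _ 0]
  · simp
  · intro d hd
    rw [coeff_zero_eq_constantCoeff_apply, map_pow, constantCoeff_binom, zero_pow hd, smul_zero]

/-- Only the power B^(a+b) contains this monomial, and it does so in a single term of its binomial
expansion. -/
theorem coeff_binomPow (c : K) (a b : ℕ) : coeff (expo (a * N) (b * N')) (binomPow N N' c) =
    Ring.choose c (a + b) * ((a + b).choose a : K) := by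
  classical
  have hmem : ∀ d m, m < d + 1 → expo (a * N) (b * N') = expo (m * N) ((d - m) * N') →
      m = a ∧ d = a + b := by
    intro d m hm h
    rw [expo_inj] at h
    have h1 := Nat.eq_of_mul_eq_mul_right (Nat.pos_of_neZero N) h.1
    have h2 := Nat.eq_of_mul_eq_mul_right (Nat.pos_of_neZero N') h.2
    omega
  rw [binomPow, PowerSeries.coeff_subst hasSubst_binom, finsum_eq_single _ (a + b)]
  · rw [PowerSeries.binomialSeries_coeff, binom_pow, map_sum, Finset.sum_eq_single a]
    · rw [Nat.add_sub_cancel_left, coeff_monomial_same, smul_eq_mul, smul_eq_mul, mul_one]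
    · intro m hm hma
      refine coeff_monomial_ne (fun h => hma ?_) _
      exact (hmem _ _ (Finset.mem_range.mp hm) h).1
    · intro h
      exact absurd (Finset.mem_range.mpr (by omega)) h
  · intro d hd
    rw [binom_pow, map_sum, Finset.sum_eq_zero, smul_zero]
    intro m hm
    refine coeff_monomial_ne (fun h => hd ?_) _
    exact (hmem _ _ (Finset.mem_range.mp hm) h).2

theorem latticeSupported_binomPow (c : K) : LatticeSupported N N' (binomPow N N' c) := by
  intro m hm
  rw [binomPow, PowerSeries.coeff_subst hasSubst_binom] at hm
  obtain ⟨d, hd⟩ : ∃ d, coeff m (binom K N N' ^ d) ≠ 0 := by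
    by_contra! h
    exact hm (finsum_eq_zero_of_forall_eq_zero fun d => by rw [h d, smul_zero])
  have hpow : LatticeSupported N N' (binom K N N' ^ d) := by
    clear hd
    induction d with
    | zero => simpa using latticeSupported_C (N := N) (N' := N') (1 : K)
    | succ d ih => rw [pow_succ]; exact ih.mul latticeSupported_binom
  exact hpow m hd

end System

/-! ### The integrable system, its first integrals and the Melnikov numbers. -/

section Integrable

open MvPowerSeries

variable {K : Type*} [Field K]

/-- The factor `a (1 + x ^ N + y ^ N') + s θ_i (x ^ N + y ^ N')`. -/
def cofactor (N N' : ℕ) (s : K) (i : Fin 2) (a : ℕ) : MvPowerSeries (Fin 2) K :=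
  (a : MvPowerSeries (Fin 2) K) * (1 + binom K N N') + C s * euler i (binom K N N')

/-- The nonlinear part of `ẋ` for the vector field with first integral
`x ^ q * y ^ p * (1 + x ^ N + y ^ N') ^ s`. -/
def sysP (p N N' : ℕ) (s : K) : MvPowerSeries (Fin 2) K :=
  X 0 * ((p : MvPowerSeries (Fin 2) K) * binom K N N' + C s * euler 1 (binom K N N'))

/-- The nonlinear part of `ẏ` for the vector field with first integral
`x ^ q * y ^ p * (1 + x ^ N + y ^ N') ^ s`. -/
def sysQ (q N N' : ℕ) (s : K) : MvPowerSeries (Fin 2) K :=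
  -(X 1 * ((q : MvPowerSeries (Fin 2) K) * binom K N N' + C s * euler 0 (binom K N N')))

/-- The cofactors are (1 + B) times the logarithmic Euler derivatives of Φ, so the derivative along
the field is the Jacobian of G and Φ, up to the factor (1 + B)/Φ. This form makes the powers of Φ
first integrals. -/
theorem lieDeriv_sys (p q N N' : ℕ) (s : K) (G : MvPowerSeries (Fin 2) K) :
    lieDeriv p q (sysP p N N' s) (sysQ q N N' s) G =
      euler 0 G * cofactor N N' s 1 p - euler 1 G * cofactor N N' s 0 q := by
  simp only [lieDeriv, sysP, sysQ, cofactor, euler_apply]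
  ring

variable {p q : ℕ}

theorem resExp_zero : resExp p q 0 = q := by simp [resExp]

theorem resExp_one : resExp p q 1 = p := by simp [resExp]

theorem degree_resExp : (resExp p q).degree = p + q := by simp [resExp, add_comm]

theorem exists_eq_smul_resExp (hp : 0 < p) (hpq : Nat.Coprime p q) {m : Fin 2 →₀ ℕ}
    (h : p * m 0 = q * m 1) : ∃ c : ℕ, m = c • resExp p q := by
  obtain ⟨c, hc⟩ : p ∣ m 1 := hpq.dvd_of_dvd_mul_left (h ▸ dvd_mul_right p (m 0))
  have h0 : m 0 = q * c := by
    rw [hc] at h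
    exact Nat.eq_of_mul_eq_mul_left hp (by rw [h]; ring)
  refine ⟨c, ?_⟩
  rw [smul_resExp, ← expo_eq m, h0, hc, mul_comm q, mul_comm p]

/-- Multiplying by a weight W with constant term 1 does not change the first nonzero term of a
resonant series. This lets saddle values be read off by weighted coefficient functionals. -/
theorem coeff_resonant_mul {F W : MvPowerSeries (Fin 2) K} {L : ℕ → K} {k : ℕ} (hpq : 0 < p + q)
    (hk : 1 ≤ k) (hL : ∀ k : ℕ, 1 ≤ k → coeff ((k + 1) • resExp p q) F = L k)
    (h0 : ∀ m : Fin 2 →₀ ℕ, (∀ k : ℕ, 1 ≤ k → m ≠ (k + 1) • resExp p q) → coeff m F = 0)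
    (hlt : ∀ i, 1 ≤ i → i < k → L i = 0) (hW : coeff 0 W = 1) :
    coeff ((k + 1) • resExp p q) (F * W) = L k := by
  classical
  rw [coeff_mul, Finset.sum_eq_single ((k + 1) • resExp p q, 0)]
  · rw [hL k hk, hW, mul_one]
  · intro ab hab hne
    rw [Finset.HasAntidiagonal.mem_antidiagonal] at hab
    by_cases h : ∀ i : ℕ, 1 ≤ i → ab.1 ≠ (i + 1) • resExp p q
    · rw [h0 _ h, zero_mul]
    · push Not at h
      obtain ⟨i, hi, hab1⟩ := h
      rcases Nat.lt_trichotomy i k with hik | rfl | hik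
      · rw [hab1, hL i hi, hlt i hi hik, zero_mul]
      · refine absurd (Prod.ext hab1 ?_) hne
        rw [hab1] at hab
        simpa using hab
      · exfalso
        have := congrArg Finsupp.degree hab
        rw [map_add, hab1, map_nsmul, map_nsmul, degree_resExp, smul_eq_mul, smul_eq_mul] at this
        have := Nat.mul_lt_mul_of_pos_right (show k + 1 < i + 1 by omega) hpq
        omega
  · intro h
    exact absurd (by simp) h

variable [CharZero K]

/-- The `i`-th power of the first integral `x ^ q * y ^ p * (1 + x ^ N + y ^ N') ^ s`. -/
def integralPow (p q N N' : ℕ) (s : K) (i : ℕ) : MvPowerSeries (Fin 2) K :=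
  monomial (i • resExp p q) 1 * binomPow N N' (i * s)

variable {N N' : ℕ} [NeZero N] [NeZero N'] {s : K}

theorem euler_monomial_mul_binomPow (i : Fin 2) (d : Fin 2 →₀ ℕ) (c : K) :
    euler i (monomial d 1 * binomPow N N' c) =
      C (d i : K) * (monomial d 1 * binomPow N N' c) +
        C c * (monomial d 1 * (euler i (binom K N N') * binomPow N N' (c - 1))) := by
  rw [euler_mul, euler_binomPow, euler_monomial]
  ring

theorem euler_zero_integralPow (i : ℕ) : euler 0 (integralPow p q N N' s i) =
    C (i : K) * (monomial (i • resExp p q) 1 *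
      (cofactor N N' s 0 q * binomPow N N' (i * s - 1))) := by
  rw [integralPow, euler_monomial_mul_binomPow, cofactor,
    ← one_add_mul_binomPow (sub_add_cancel (i * s) (1 : K))]
  simp only [Finsupp.smul_apply, resExp_zero, smul_eq_mul, Nat.cast_mul, map_mul, map_natCast]
  ring

theorem euler_one_integralPow (i : ℕ) : euler 1 (integralPow p q N N' s i) =
    C (i : K) * (monomial (i • resExp p q) 1 *
      (cofactor N N' s 1 p * binomPow N N' (i * s - 1))) := by
  rw [integralPow, euler_monomial_mul_binomPow, cofactor,
    ← one_add_mul_binomPow (sub_add_cancel (i * s) (1 : K))]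
  simp only [Finsupp.smul_apply, resExp_one, smul_eq_mul, Nat.cast_mul, map_mul, map_natCast]
  ring

theorem lieDeriv_integralPow (i : ℕ) :
    lieDeriv p q (sysP p N N' s) (sysQ q N N' s) (integralPow p q N N' s i) = 0 := by
  rw [lieDeriv_sys, euler_zero_integralPow, euler_one_integralPow]
  ring

/-- The image of the vector field is killed by a weighted coefficient functional. -/
theorem coeff_lieDeriv_mul_binomPow {J : ℕ} (hJ : J ≠ 0) (G : MvPowerSeries (Fin 2) K) :
    coeff (J • resExp p q) (lieDeriv p q (sysP p N N' s) (sysQ q N N' s) G *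
      binomPow N N' (-(s * J) - 1)) = 0 := by
  set E := binomPow N N' (-(s * J)) with hE
  set W := binomPow N N' (-(s * J) - 1) with hW
  have hEW : E = (1 + binom K N N') * W := (one_add_mul_binomPow (sub_add_cancel _ _)).symm
  have hD : ∀ i, euler i E = C (-(s * J)) * W * euler i (binom K N N') :=
    fun i => euler_binomPow i _
  -- Integration by parts: E is Φ^(-J) stripped of its monomial, and the right side is a divergence.
  -- The operators Jp - θ_y and Jq - θ_x both annihilate the coefficient at x^(Jq) y^(Jp).
  have key : C (J : K) * (lieDeriv p q (sysP p N N' s) (sysQ q N N' s) G * W) =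
      (C ((J * p : ℕ) : K) * (E * euler 0 G) - euler 1 (E * euler 0 G)) -
        (C ((J * q : ℕ) : K) * (E * euler 1 G) - euler 0 (E * euler 1 G)) := by
    rw [lieDeriv_sys, euler_mul, euler_mul, hD, hD, euler_comm 0 1, hEW, cofactor, cofactor]
    simp only [Nat.cast_mul, map_mul, map_natCast, map_neg]
    ring
  have h0 := congrArg (coeff (J • resExp p q)) key
  rw [map_sub, map_sub, map_sub, coeff_C_mul, coeff_C_mul, coeff_C_mul, coeff_euler, coeff_euler,
    Finsupp.smul_apply, Finsupp.smul_apply, resExp_zero, resExp_one, smul_eq_mul, smul_eq_mul,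
    sub_self, sub_self, sub_zero] at h0
  exact (mul_eq_zero.mp h0).resolve_left (Nat.cast_ne_zero.mpr hJ)

theorem coeff_integralPow_self (i : ℕ) :
    coeff (i • resExp p q) (integralPow p q N N' s i) = 1 := by
  have h := coeff_add_monomial_mul (i • resExp p q) 0 (binomPow N N' (i * s)) (1 : K)
  rw [add_zero] at h
  rw [integralPow, h, constantCoeff_binomPow, mul_one]

/-- Degree by degree, a nonresonant coefficient is determined by those of lower degree, because p m₀
- q m₁ ≠ 0. Only the resonant ones are free. -/
theorem coeff_eq_zero_of_lieDeriv_eq_zero {P Q D : MvPowerSeries (Fin 2) K}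
    (hp : 0 < p) (hpq : Nat.Coprime p q)
    (hP : ∀ m : Fin 2 →₀ ℕ, m.degree < 2 → coeff m P = 0)
    (hQ : ∀ m : Fin 2 →₀ ℕ, m.degree < 2 → coeff m Q = 0)
    (hD : lieDeriv p q P Q D = 0) (B : ℕ)
    (hres : ∀ c : ℕ, (c • resExp p q).degree < B → coeff (c • resExp p q) D = 0) :
    ∀ m : Fin 2 →₀ ℕ, m.degree < B → coeff m D = 0 := by
  have key : ∀ d : ℕ, ∀ m : Fin 2 →₀ ℕ, m.degree = d → m.degree < B → coeff m D = 0 := by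
    intro d
    induction d using Nat.strong_induction_on with
    | _ d ih =>
    intro m hm hmB
    have h0 : ∀ a : Fin 2 →₀ ℕ, a.degree < m.degree →
        coeff a D = coeff a (0 : MvPowerSeries (Fin 2) K) := by
      intro a ha
      rw [ih a.degree (hm ▸ ha) a rfl (ha.trans hmB), map_zero]
    have h1 := coeff_lieDeriv p q P Q D m
    rw [hD, map_zero, map_add, coeff_pderiv_mul_congr 0 hP m h0,
      coeff_pderiv_mul_congr 1 hQ m h0] at h1
    simp only [map_zero, zero_mul, add_zero] at h1
    rcases mul_eq_zero.mp h1.symm with h | h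
    · obtain ⟨c, rfl⟩ := exists_eq_smul_resExp hp hpq (m := m)
        (by exact_mod_cast sub_eq_zero.mp h)
      exact hres c hmB
    · exact h
  exact fun m hm => key _ m rfl hm

/-- A formal first integral is a power series in `x ^ q * y ^ p * (1 + x ^ N + y ^ N') ^ s`. -/
theorem exists_integral_expansion (hp : 0 < p) (hq : 0 < q) (hpq : Nat.Coprime p q)
    (hP : ∀ m : Fin 2 →₀ ℕ, m.degree < 2 → coeff m (sysP p N N' s) = 0)
    (hQ : ∀ m : Fin 2 →₀ ℕ, m.degree < 2 → coeff m (sysQ q N N' s) = 0)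
    {G : MvPowerSeries (Fin 2) K} (hG : lieDeriv p q (sysP p N N' s) (sysQ q N N' s) G = 0)
    (B : ℕ) : ∃ c : ℕ → K, ∀ m : Fin 2 →₀ ℕ, m.degree < B * (p + q) →
      coeff m (G - ∑ i ∈ Finset.range B, C (c i) * integralPow p q N N' s i) = 0 := by
  induction B with
  | zero => exact ⟨0, fun m hm => by omega⟩
  | succ B ih =>
    obtain ⟨c, hc⟩ := ih
    set D := G - ∑ i ∈ Finset.range B, C (c i) * integralPow p q N N' s i with hDdef
    -- Subtracting this multiple of Φ^B removes the one resonant coefficient of degree B(p + q),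
    -- which is all that the next stage leaves free.
    set a := coeff (B • resExp p q) D with ha
    have hsum : ∑ i ∈ Finset.range (B + 1),
        C (Function.update c B a i) * integralPow p q N N' s i =
        ∑ i ∈ Finset.range B, C (c i) * integralPow p q N N' s i +
          C a * integralPow p q N N' s B := by
      rw [Finset.sum_range_succ, Function.update_self]
      congr 1
      refine Finset.sum_congr rfl fun i hi => ?_
      rw [Function.update_of_ne (Finset.mem_range.mp hi).ne]
    refine ⟨Function.update c B a, ?_⟩
    rw [hsum, ← sub_sub, ← hDdef]
    have hlin : ∀ (b : K) (F : MvPowerSeries (Fin 2) K), lieDeriv p q (sysP p N N' s)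
        (sysQ q N N' s) F = 0 → lieDeriv p q (sysP p N N' s) (sysQ q N N' s) (C b * F) = 0 := by
      intro b F hF
      rw [lieDeriv_sys] at hF ⊢
      rw [euler_C_mul, euler_C_mul, mul_assoc, mul_assoc, ← mul_sub, hF, mul_zero]
    have hsub : ∀ F₁ F₂ : MvPowerSeries (Fin 2) K, lieDeriv p q (sysP p N N' s)
        (sysQ q N N' s) F₁ = 0 → lieDeriv p q (sysP p N N' s) (sysQ q N N' s) F₂ = 0 →
        lieDeriv p q (sysP p N N' s) (sysQ q N N' s) (F₁ - F₂) = 0 := by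
      intro F₁ F₂ h1 h2
      rw [lieDeriv_sys] at h1 h2 ⊢
      rw [map_sub, map_sub, sub_mul, sub_mul, sub_sub_sub_comm, h1, h2, sub_zero]
    have hD : lieDeriv p q (sysP p N N' s) (sysQ q N N' s) D = 0 := by
      refine hsub _ _ hG ?_
      have : ∀ i ∈ Finset.range B, lieDeriv p q (sysP p N N' s) (sysQ q N N' s)
          (C (c i) * integralPow p q N N' s i) = 0 :=
        fun i _ => hlin _ _ (lieDeriv_integralPow i)
      simp only [lieDeriv_sys] at this ⊢
      rw [map_sum, map_sum, Finset.sum_mul, Finset.sum_mul, ← Finset.sum_sub_distrib]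
      exact Finset.sum_eq_zero this
    refine coeff_eq_zero_of_lieDeriv_eq_zero hp hpq hP hQ
      (hsub _ _ hD (hlin a _ (lieDeriv_integralPow B))) _ fun k hk => ?_
    rw [map_nsmul, degree_resExp, smul_eq_mul] at hk
    have hkB : k < B + 1 := Nat.lt_of_mul_lt_mul_right hk
    rw [map_sub, coeff_C_mul]
    rcases Nat.lt_succ_iff_lt_or_eq.mp hkB with h | rfl
    · have hlt : (k • resExp p q).degree < (B • resExp p q).degree := by
        rw [map_nsmul, map_nsmul, degree_resExp, smul_eq_mul, smul_eq_mul]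
        exact Nat.mul_lt_mul_of_pos_right h (by omega)
      rw [hc, integralPow, coeff_monomial_mul_of_degree_lt hlt, mul_zero, sub_zero]
      rwa [map_nsmul (Finsupp.degree) B, degree_resExp, smul_eq_mul] at hlt
    · rw [coeff_integralPow_self, mul_one, ← ha, sub_self]

/-- The first-order variation of the saddle values under the perturbation `x ^ v * x ∂/∂x`. -/
def melnikov (p q N N' : ℕ) (s : K) (v : Fin 2 →₀ ℕ) (k : ℕ) : K :=
  coeff (k • resExp p q) (monomial v 1 * (cofactor N N' s 0 q * binomPow N N' (-(s * k) - 2)))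

/-- Apply θ_x to x^v (1 + B)^(-sk-1): at x^(kq) y^(kp) it acts as multiplication by kq, which
eliminates the term containing θ_x B. -/
theorem mul_melnikov (v : Fin 2 →₀ ℕ) (k : ℕ) :
    (s * k + 1) * melnikov p q N N' s v k = (q + s * v 0) *
      coeff (k • resExp p q) (monomial v 1 * binomPow N N' (-(s * k) - 1)) := by
  have h1 := euler_monomial_mul_binomPow (N := N) (N' := N') 0 v (-(s * k) - 1)
  rw [show -(s * k) - 1 - 1 = -(s * k) - 2 by ring] at h1
  have h2 : monomial v 1 * (cofactor N N' s 0 q * binomPow N N' (-(s * k) - 2)) =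
      C (q : K) * (monomial v 1 * binomPow N N' (-(s * k) - 1)) +
      C s * (monomial v 1 * (euler 0 (binom K N N') * binomPow N N' (-(s * k) - 2))) := by
    rw [← one_add_mul_binomPow (show -(s * k) - 2 + 1 = -(s * k) - 1 by ring), cofactor,
      map_natCast]
    ring
  have h3 := congrArg (coeff (k • resExp p q)) h1
  rw [coeff_euler, map_add, coeff_C_mul, coeff_C_mul, Finsupp.smul_apply, resExp_zero,
    smul_eq_mul, Nat.cast_mul] at h3
  rw [melnikov, h2, map_add, coeff_C_mul, coeff_C_mul]
  linear_combination s * h3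

/-- Everything multiplying x^v is a series in x^N and y^N'. Arguing by support, not through
`mul_melnikov`, also covers the case sk + 1 = 0. -/
theorem melnikov_eq_zero_of_forall {v : Fin 2 →₀ ℕ} {k : ℕ}
    (h : ∀ a b : ℕ, k * q = v 0 + a * N → k * p = v 1 + b * N' → False) :
    melnikov p q N N' s v k = 0 := by
  classical
  rw [melnikov, coeff_monomial_mul]
  split_ifs with hle
  · by_contra h0
    have hsup : LatticeSupported N N' (cofactor N N' s 0 q * binomPow N N' (-(s * k) - 2)) := by
      refine LatticeSupported.mul ?_ (latticeSupported_binomPow _)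
      have h1 : LatticeSupported N N' (1 + binom K N N') := by
        have := latticeSupported_binomPow (N := N) (N' := N') (1 : K)
        rwa [binomPow_one] at this
      rw [cofactor, ← map_natCast (C (σ := Fin 2) (R := K))]
      exact ((latticeSupported_C _).mul h1).add
        ((latticeSupported_C _).mul (latticeSupported_binom.euler 0))
    obtain ⟨⟨a, ha⟩, b, hb⟩ := hsup _ (right_ne_zero_of_mul h0)
    have hle0 := hle 0
    have hle1 := hle 1
    simp only [Finsupp.tsub_apply, Finsupp.smul_apply, resExp_zero, resExp_one, smul_eq_mul]
      at ha hb hle0 hle1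
    exact h a b (by rw [mul_comm a]; omega) (by rw [mul_comm b]; omega)
  · rfl

theorem coeff_monomial_mul_binomPow {v : Fin 2 →₀ ℕ} {k a b : ℕ} (ha : k * q = v 0 + a * N)
    (hb : k * p = v 1 + b * N') (c : K) :
    coeff (k • resExp p q) (monomial v 1 * binomPow N N' c) =
      Ring.choose c (a + b) * ((a + b).choose a : K) := by
  have h : k • resExp p q = v + expo (a * N) (b * N') := by
    rw [smul_resExp, ha, hb]
    ext i
    fin_cases i <;> simp [expo]
  rw [h, coeff_add_monomial_mul, one_mul, coeff_binomPow]

/-- The factor Φ^i shifts the exponent by i resonant steps and turns the weight for J into the one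
for J - i. -/
theorem coeff_euler_integralPow_mul (hp : 0 < p) (v : Fin 2 →₀ ℕ) (J i : ℕ) :
    coeff (J • resExp p q) (monomial v 1 * euler 0 (integralPow p q N N' s i) *
      binomPow N N' (-(s * J) - 1)) =
      if i ≤ J then (i : K) * melnikov p q N N' s v (J - i) else 0 := by
  have h : monomial v 1 * euler 0 (integralPow p q N N' s i) * binomPow N N' (-(s * J) - 1) =
      C (i : K) * (monomial (i • resExp p q) 1 *
        (monomial v 1 * (cofactor N N' s 0 q * binomPow N N' (-(s * (J - i)) - 2)))) := by
    rw [euler_zero_integralPow, ← binomPow_mul_binomPow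
      (show (i * s - 1) + (-(s * J) - 1) = -(s * (J - i)) - 2 by ring)]
    ring
  rw [h, coeff_C_mul]
  split_ifs with hi
  · obtain ⟨k, rfl⟩ := exists_add_of_le hi
    rw [add_smul, coeff_add_monomial_mul, one_mul, melnikov, Nat.add_sub_cancel_left]
    push_cast
    rw [add_sub_cancel_left]
  · rw [coeff_monomial_mul_of_degree_lt, mul_zero]
    rw [map_nsmul, map_nsmul, degree_resExp, smul_eq_mul, smul_eq_mul]
    exact Nat.mul_lt_mul_of_pos_right (by omega) (by omega)

end Integrable

/-! ### First saddle value of the perturbed system. -/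

section Main

open MvPowerSeries

variable {K : Type*} [Field K] {p q N N' : ℕ} [NeZero N] [NeZero N'] {s : K}

theorem coeff_X_mul_binom_eq_zero {n : ℕ} (hN : N + 1 ≤ n) (hN' : N' + 1 ≤ n) (i j : Fin 2)
    (a : ℕ) (s : K) {m : Fin 2 →₀ ℕ} (hm : ¬(2 ≤ m.degree ∧ m.degree ≤ n)) :
    coeff m (X i * ((a : MvPowerSeries (Fin 2) K) * binom K N N' +
      C s * euler j (binom K N N'))) = 0 := by
  classical
  rw [X_def, coeff_monomial_mul]
  split_ifs with hle
  · obtain ⟨d, rfl⟩ := exists_add_of_le hle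
    rw [add_tsub_cancel_left, one_mul, map_add, coeff_C_mul, coeff_euler,
      ← map_natCast (C (σ := Fin 2) (R := K)), coeff_C_mul]
    by_cases h0 : coeff d (binom K N N') = 0
    · rw [h0]
      ring
    · exfalso
      apply hm
      have := NeZero.pos N
      have := NeZero.pos N'
      rw [map_add, Finsupp.degree_single]
      rcases degree_of_coeff_binom_ne_zero h0 with h | h <;> omega
  · rfl

theorem coeff_sysP_eq_zero {n : ℕ} (hN : N + 1 ≤ n) (hN' : N' + 1 ≤ n) {m : Fin 2 →₀ ℕ}
    (hm : ¬(2 ≤ m.degree ∧ m.degree ≤ n)) : coeff m (sysP p N N' s) = 0 :=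
  coeff_X_mul_binom_eq_zero hN hN' _ _ _ _ hm

theorem coeff_sysQ_eq_zero {n : ℕ} (hN : N + 1 ≤ n) (hN' : N' + 1 ≤ n) {m : Fin 2 →₀ ℕ}
    (hm : ¬(2 ≤ m.degree ∧ m.degree ≤ n)) : coeff m (sysQ q N N' s) = 0 := by
  rw [sysQ, map_neg, coeff_X_mul_binom_eq_zero hN hN' _ _ _ _ hm, neg_zero]

theorem coeff_sysP_of_lt {m : Fin 2 →₀ ℕ} (hm : m.degree < 2) : coeff m (sysP p N N' s) = 0 :=
  coeff_sysP_eq_zero (n := N + N' + 1) (by omega) (by omega) (by omega)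

theorem coeff_sysQ_of_lt {m : Fin 2 →₀ ℕ} (hm : m.degree < 2) : coeff m (sysQ q N N' s) = 0 :=
  coeff_sysQ_eq_zero (n := N + N' + 1) (by omega) (by omega) (by omega)

variable [CharZero K]

theorem coeff_resExp_integralPow (hp : 0 < p) (i : ℕ) :
    coeff (resExp p q) (integralPow p q N N' s i) = if i = 1 then 1 else 0 := by
  classical
  have hdeg : (resExp p q).degree = p + q := degree_resExp
  split_ifs with h
  · have := coeff_integralPow_self (p := p) (q := q) (N := N) (N' := N') (s := s) 1
    rwa [one_smul, ← h] at this
  · rcases Nat.lt_or_gt_of_ne h with h1 | h1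
    · obtain rfl : i = 0 := by omega
      rw [integralPow, Nat.cast_zero, zero_mul, binomPow_zero, mul_one, zero_smul,
        coeff_monomial_ne]
      intro h0
      rw [h0, map_zero] at hdeg
      omega
    · rw [integralPow, coeff_monomial_mul_of_degree_lt]
      rw [map_nsmul, hdeg, smul_eq_mul]
      nlinarith

/-- The first nonzero `melnikov` value is the first nonzero value of the weighted coefficient
functional on the perturbation of any normalized first integral. -/
theorem coeff_perturbation (hp : 0 < p) (hq : 0 < q) (hpq : Nat.Coprime p q)
    {G : MvPowerSeries (Fin 2) K} (hG : lieDeriv p q (sysP p N N' s) (sysQ q N N' s) G = 0)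
    (hG1 : coeff (resExp p q) G = 1) (v : Fin 2 →₀ ℕ) (k : ℕ)
    (hk : ∀ i < k, melnikov p q N N' s v i = 0) :
    coeff ((k + 1) • resExp p q) (monomial v 1 * euler 0 G *
      binomPow N N' (-(s * (k + 1 : ℕ)) - 1)) = melnikov p q N N' s v k := by
  obtain ⟨c, hc⟩ := exists_integral_expansion hp hq hpq (fun _ => coeff_sysP_of_lt)
    (fun _ => coeff_sysQ_of_lt) hG (k + 2)
  set D := G - ∑ i ∈ Finset.range (k + 2), C (c i) * integralPow p q N N' s i with hD
  have hGD : G = D + ∑ i ∈ Finset.range (k + 2), C (c i) * integralPow p q N N' s i := by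
    rw [hD, sub_add_cancel]
  have hc1 : c 1 = 1 := by
    rw [hGD, map_add, hc _ (by rw [degree_resExp]; nlinarith), zero_add, map_sum,
      Finset.sum_eq_single 1] at hG1
    · rwa [coeff_C_mul, coeff_resExp_integralPow hp, if_pos rfl, mul_one] at hG1
    · intro i _ hi
      rw [coeff_C_mul, coeff_resExp_integralPow hp, if_neg hi, mul_zero]
    · intro h
      exact absurd (Finset.mem_range.mpr (by omega)) h
  have hDz : coeff ((k + 1) • resExp p q) (monomial v 1 * euler 0 D *
      binomPow N N' (-(s * (k + 1 : ℕ)) - 1)) = 0 := by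
    rw [show monomial v 1 * euler 0 D * binomPow N N' (-(s * (k + 1 : ℕ)) - 1) =
      euler 0 D * (monomial v 1 * binomPow N N' (-(s * (k + 1 : ℕ)) - 1)) by ring]
    refine coeff_mul_eq_zero_of_degree_lt (d := (k + 2) * (p + q)) ?_ _ ?_
    · intro m hm
      rw [coeff_euler, hc m hm, mul_zero]
    · rw [map_nsmul, degree_resExp, smul_eq_mul]
      nlinarith
  have hsum : monomial v 1 * euler 0 G * binomPow N N' (-(s * (k + 1 : ℕ)) - 1) =
      monomial v 1 * euler 0 D * binomPow N N' (-(s * (k + 1 : ℕ)) - 1) +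
      ∑ i ∈ Finset.range (k + 2), C (c i) * (monomial v 1 *
        euler 0 (integralPow p q N N' s i) * binomPow N N' (-(s * (k + 1 : ℕ)) - 1)) := by
    rw [hGD, map_add, map_sum, mul_add, add_mul, Finset.mul_sum, Finset.sum_mul]
    congr 1
    refine Finset.sum_congr rfl fun i _ => ?_
    rw [euler_C_mul]
    ring
  -- In G = ∑ c_i Φ^i, the term i = 0 is constant and the terms i ≥ 2 give `melnikov` numbers of
  -- index k + 1 - i < k, which vanish. Only i = 1 remains, with c₁ = 1.
  rw [hsum, map_add, hDz, zero_add, map_sum, Finset.sum_eq_single 1]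
  · rw [coeff_C_mul, coeff_euler_integralPow_mul hp, if_pos (by omega), hc1, one_mul,
      Nat.cast_one, one_mul, Nat.add_sub_cancel]
  · intro i hi hi1
    rw [coeff_C_mul, coeff_euler_integralPow_mul hp]
    rcases Nat.eq_zero_or_pos i with rfl | hpos
    · simp
    · have hi2 := Finset.mem_range.mp hi
      rw [if_pos (by omega), hk _ (by omega), mul_zero, mul_zero]
  · intro h
    exact absurd (Finset.mem_range.mpr (by omega)) h

/-- Saddle values of the perturbed integrable system over the dual numbers. -/
theorem saddleValues_dual (hp : 0 < p) (hq : 0 < q) (hpq : Nat.Coprime p q)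
    {L : ℕ → DualNumber K} (v : Fin 2 →₀ ℕ)
    (hL : IsSaddleValues p q (dualSeries (sysP p N N' s) (X 0 * monomial v 1))
      (dualSeries (sysQ q N N' s) 0) L) (J : ℕ) (hJ : 1 ≤ J)
    (h0 : ∀ i < J, melnikov p q N N' s v i = 0) (h1 : melnikov p q N N' s v J ≠ 0) :
    (∀ k, 1 ≤ k → k < J → L k = 0) ∧ L J ≠ 0 := by
  obtain ⟨H, hH1, hH2, hH3⟩ := hL
  set G := fstSeries H with hG
  have hF0 : fstSeries (lieDeriv p q (dualSeries (sysP p N N' s) (X 0 * monomial v 1))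
      (dualSeries (sysQ q N N' s) 0) H) =
      lieDeriv p q (sysP p N N' s) (sysQ q N N' s) G := by
    rw [fstSeries_lieDeriv, fstSeries_dualSeries, fstSeries_dualSeries]
  have hF1 : sndSeries (lieDeriv p q (dualSeries (sysP p N N' s) (X 0 * monomial v 1))
      (dualSeries (sysQ q N N' s) 0) H) =
      lieDeriv p q (sysP p N N' s) (sysQ q N N' s) (sndSeries H) + monomial v 1 * euler 0 G := by
    rw [sndSeries_lieDeriv, fstSeries_dualSeries, fstSeries_dualSeries, sndSeries_dualSeries,
      sndSeries_dualSeries, euler_apply]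
    ring
  set F0 := lieDeriv p q (sysP p N N' s) (sysQ q N N' s) G with hF0def
  -- Integrability: the functional at J = k + 1 kills the image of the field, yet reads off the
  -- first nonzero real part.
  have hfst : ∀ k, 1 ≤ k → TrivSqZeroExt.fst (L k) = 0 := by
    intro k
    induction k using Nat.strong_induction_on with
    | _ k ih =>
      intro hk
      rw [← coeff_resonant_mul (p := p) (q := q) (F := F0)
        (L := fun k => TrivSqZeroExt.fst (L k)) (by omega) hk
        (fun i hi => by rw [← hF0, coeff_fstSeries, hH2 i hi])
        (fun m hm => by rw [← hF0, coeff_fstSeries, hH3 m hm, TrivSqZeroExt.fst_zero])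
        (fun i hi hik => ih i hik hi) (constantCoeff_binomPow (N := N) (N' := N')
          (-(s * (k + 1 : ℕ)) - 1))]
      exact coeff_lieDeriv_mul_binomPow (by omega) G
  have hF0z : F0 = 0 := by
    ext m
    rw [map_zero, ← hF0, coeff_fstSeries]
    by_cases h : ∀ k : ℕ, 1 ≤ k → m ≠ (k + 1) • resExp p q
    · rw [hH3 m h, TrivSqZeroExt.fst_zero]
    · push Not at h
      obtain ⟨k, hk, rfl⟩ := h
      rw [hH2 k hk, hfst k hk]
  have hG1 : coeff (resExp p q) G = 1 := by
    rw [hG, coeff_fstSeries, hH1 _ degree_resExp.le, if_pos rfl, TrivSqZeroExt.fst_one]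
  -- The same functional discards the unknown ε-part of H and keeps only x^v θ_x G, so the choice of
  -- H does not matter.
  have hsnd : ∀ k, 1 ≤ k → k ≤ J → (∀ i, 1 ≤ i → i < k → TrivSqZeroExt.snd (L i) = 0) →
      TrivSqZeroExt.snd (L k) = melnikov p q N N' s v k := by
    intro k hk hkJ hlt
    rw [← coeff_resonant_mul (p := p) (q := q)
      (F := lieDeriv p q (sysP p N N' s) (sysQ q N N' s) (sndSeries H) + monomial v 1 * euler 0 G)
      (L := fun k => TrivSqZeroExt.snd (L k)) (by omega) hk
      (fun i hi => by rw [← hF1, coeff_sndSeries, hH2 i hi])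
      (fun m hm => by rw [← hF1, coeff_sndSeries, hH3 m hm, TrivSqZeroExt.snd_zero])
      hlt (constantCoeff_binomPow (N := N) (N' := N') (-(s * (k + 1 : ℕ)) - 1)), add_mul, map_add,
      coeff_lieDeriv_mul_binomPow (by omega), zero_add,
      coeff_perturbation hp hq hpq hF0z hG1 v k (fun i hi => h0 i (by omega))]
  have hzero : ∀ k, 1 ≤ k → k < J → TrivSqZeroExt.snd (L k) = 0 := by
    intro k
    induction k using Nat.strong_induction_on with
    | _ k ih =>
      intro hk hkJ
      rw [hsnd k hk hkJ.le fun i hi hik => ih i hik hi (hik.trans hkJ), h0 k hkJ]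
  refine ⟨fun k hk hkJ => TrivSqZeroExt.ext (hfst k hk) (hzero k hk hkJ), fun h => h1 ?_⟩
  rw [← hsnd J hJ le_rfl hzero, h, TrivSqZeroExt.snd_zero]

end Main

/-! ### Choice of parameters and the quadratic bound. -/

section Bound

open MvPowerSeries

variable {𝕜 : Type*} [Field 𝕜] [CharZero 𝕜] {p q : ℕ}

/-- Adding tq and tp to the two equations gives N ∣ (i + t)q and N' ∣ (i + t)p, hence NN' ∣ i + t.
The range of i leaves only the first multiple. -/
theorem eq_of_resonance {N N' t vx vy i a b : ℕ} (hNN : Nat.Coprime N N') (hNq : Nat.Coprime N q)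
    (hNp : Nat.Coprime N' p) (ht : 0 < t) (hx : vx + t * q = N) (hy : vy + t * p = N')
    (hi : i < 2 * (N * N') - t) (ha : i * q = vx + a * N) (hb : i * p = vy + b * N') :
    i = N * N' - t := by
  have h1 : N ∣ i + t := by
    refine hNq.dvd_of_dvd_mul_right ⟨a + 1, ?_⟩
    rw [add_mul, ha, mul_add, mul_one, mul_comm N a]
    omega
  have h2 : N' ∣ i + t := by
    refine hNp.dvd_of_dvd_mul_right ⟨b + 1, ?_⟩
    rw [add_mul, hb, mul_add, mul_one, mul_comm N' b]
    omega
  obtain ⟨c, hc⟩ := hNN.mul_dvd_of_dvd_of_dvd h1 h2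
  have hc1 : c = 1 := by
    have h3 : 0 < c := by
      rcases Nat.eq_zero_or_pos c with rfl | h
      · omega
      · exact h
    have h4 : c < 2 := by
      by_contra! h
      have := Nat.mul_le_mul_left (N * N') h
      omega
    omega
  rw [hc1, mul_one] at hc
  omega

theorem le_idealOrder_gen (hp : 0 < p) (hq : 0 < q) (hpq : Nat.Coprime p q)
    {n N N' t vx vy : ℕ} (hN : 3 ≤ N) (hN' : 3 ≤ N') (hNN : Nat.Coprime N N')
    (hNq : Nat.Coprime N q) (hNp : Nat.Coprime N' p) (ht : 0 < t) (hx : vx + t * q = N)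
    (hy : vy + t * p = N') (hbig : 3 * t + 3 * N < N * N') (hn : N + 1 ≤ n) (hn' : N' + 1 ≤ n)
    (hv : 1 ≤ vx + vy) (hvn : vx + vy + 1 ≤ n) {L : ℕ → CoeffRing 𝕜 n}
    (hL : IsSaddleValues p q (genP 𝕜 n) (genQ 𝕜 n) L) :
    2 * (N * N') - t ≤ idealOrder L := by
  have : NeZero N := ⟨by omega⟩
  have : NeZero N' := ⟨by omega⟩
  obtain ⟨j, hj⟩ : ∃ j, j = N * N' - t := ⟨_, rfl⟩
  obtain ⟨J, hJ⟩ : ∃ J, J = 2 * (N * N') - t := ⟨_, rfl⟩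
  have hj0 : (j : 𝕜) ≠ 0 := Nat.cast_ne_zero.mpr (by omega)
  set s : 𝕜 := -2 / j with hs
  set v := expo vx vy with hvdef
  have hv0 : v 0 = vx := expo_zero_apply _ _
  have hv1 : v 1 = vy := expo_one_apply _ _
  have hqN : 3 ≤ N' * q := hN'.trans (Nat.le_mul_of_pos_right _ hq)
  have hpN : 3 ≤ N * p := hN.trans (Nat.le_mul_of_pos_right _ hp)
  have hsj : s * j = -2 := div_mul_cancel₀ _ hj0
  have h0 : ∀ i < J, melnikov p q N N' s v i = 0 := by
    intro i hi
    by_cases hij : i = j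
    · subst hij
      have h := mul_melnikov (p := p) (q := q) (N := N) (N' := N') (s := s) v i
      have hjt : i + t = N * N' := by omega
      have ha : i * q = v 0 + (N' * q - 1) * N := by
        zify [show 1 ≤ N' * q by omega] at hjt hx ⊢
        rw [hv0]
        linear_combination (q : ℤ) * hjt - hx
      have hb : i * p = v 1 + (N * p - 1) * N' := by
        zify [show 1 ≤ N * p by omega] at hjt hy ⊢
        rw [hv1]
        linear_combination (p : ℤ) * hjt - hy
      have hone : -(s * i) - 1 = ((1 : ℕ) : 𝕜) := by
        rw [hsj]
        norm_num
      rw [coeff_monomial_mul_binomPow ha hb, hone, Ring.choose_natCast,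
        Nat.choose_eq_zero_of_lt (by omega), Nat.cast_zero, zero_mul, mul_zero, hsj] at h
      refine (mul_eq_zero.mp h).resolve_left ?_
      norm_num
    · refine melnikov_eq_zero_of_forall fun a b ha hb => hij ?_
      rw [hj]
      exact eq_of_resonance hNN hNq hNp ht hx hy (hJ ▸ hi) (hv0 ▸ ha) (hv1 ▸ hb)
  have hJj : J = 2 * j + t := by omega
  have h1 : melnikov p q N N' s v J ≠ 0 := by
    intro hzero
    have h := mul_melnikov (p := p) (q := q) (N := N) (N' := N') (s := s) v J
    have hJt : J + t = 2 * (N * N') := by omega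
    have ha : J * q = v 0 + (2 * (N' * q) - 1) * N := by
      zify [show 1 ≤ 2 * (N' * q) by omega] at hJt hx ⊢
      rw [hv0]
      linear_combination (q : ℤ) * hJt - hx
    have hb : J * p = v 1 + (2 * (N * p) - 1) * N' := by
      zify [show 1 ≤ 2 * (N * p) by omega] at hJt hy ⊢
      rw [hv1]
      linear_combination (p : ℤ) * hJt - hy
    rw [hzero, mul_zero, coeff_monomial_mul_binomPow ha hb] at h
    rcases mul_eq_zero.mp h.symm with h | h
    -- The prefactor q + s v₀ vanishes only if qj = 2vx, impossible since j > 2N by `hbig`.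
    · have h2 : ((q * j : ℕ) : 𝕜) = ((2 * vx : ℕ) : 𝕜) := by
        rw [hv0] at h
        push_cast
        linear_combination (j : 𝕜) * h - (vx : 𝕜) * hsj
      have h3 : q * j = 2 * vx := by exact_mod_cast h2
      have h4 : j ≤ q * j := Nat.le_mul_of_pos_left _ hq
      omega
    · rcases mul_eq_zero.mp h with h | h
      -- A natural exponent i would give (i + 1)j = 2J = 4j + 2t, but 0 < 2t < j.
      · refine choose_ne_zero (fun i _ hi => ?_) h
        have h2 : ((2 * J : ℕ) : 𝕜) = (((i + 1) * j : ℕ) : 𝕜) := by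
          push_cast
          linear_combination (j : 𝕜) * hi + (J : 𝕜) * hsj
        have h3 : 2 * J = (i + 1) * j := by exact_mod_cast h2
        rcases Nat.lt_or_ge (i + 1) 5 with h5 | h5
        · have := Nat.mul_le_mul_right j (show i + 1 ≤ 4 by omega)
          omega
        · have := Nat.mul_le_mul_right j h5
          omega
      · rw [Nat.cast_eq_zero, Nat.choose_eq_zero_iff] at h
        omega
  have hpert : ∀ m : Fin 2 →₀ ℕ, ¬(2 ≤ m.degree ∧ m.degree ≤ n) →
      coeff m (X 0 * monomial v (1 : 𝕜)) = 0 := by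
    intro m hm
    rw [X_def, monomial_mul_monomial, coeff_monomial_ne]
    rintro rfl
    rw [map_add, Finsupp.degree_single, hvdef, degree_expo] at hm
    omega
  obtain ⟨f, hfP, hfQ⟩ := exists_map_gen (𝕜 := 𝕜) (S := DualNumber 𝕜) (n := n)
    (P := dualSeries (sysP p N N' s) (X 0 * monomial v 1)) (Q := dualSeries (sysQ q N N' s) 0)
    (fun m hm => coeff_dualSeries_eq_zero (coeff_sysP_eq_zero hn hn' hm) (hpert m hm))
    (fun m hm => coeff_dualSeries_eq_zero (coeff_sysQ_eq_zero hn hn' hm) (map_zero _))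
  have hLf := hL.map f
  rw [hfP, hfQ] at hLf
  obtain ⟨hlow, htop⟩ := saddleValues_dual hp hq hpq v hLf J (by omega) h0 h1
  rw [← hJ]
  exact le_idealOrder_of_ringHom (saddleIdeal_idealOrder L) f (by omega) hlow htop

theorem le_idealOrder_param (hp : 0 < p) (hq : 0 < q) (hpq : Nat.Coprime p q) {n a : ℕ}
    (ha : 6 ≤ a) (hn : p * q * (p + q) * a + p * q + 2 ≤ n) {L : ℕ → CoeffRing 𝕜 n}
    (hL : IsSaddleValues p q (genP 𝕜 n) (genQ 𝕜 n) L) :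
    2 * (p * q * (p + q) * a) ^ 2 ≤ idealOrder L := by
  -- Both N and N' = N + pq are 1 mod pq, which gives all the coprimality conditions. With t = pqa +
  -- 1, close to N/(p + q), the degree vx + vy + 1 of the perturbation drops from about 2N to about
  -- N, within n.
  obtain ⟨N, hNdef⟩ : ∃ N, N = p * q * (p + q) * a + 1 := ⟨_, rfl⟩
  obtain ⟨N', hNdef'⟩ : ∃ N', N' = N + p * q := ⟨_, rfl⟩
  obtain ⟨t, htdef⟩ : ∃ t, t = p * q * a + 1 := ⟨_, rfl⟩
  have hD : 1 ≤ p * q := Nat.mul_pos hp hq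
  have hpD : p ≤ p * q := Nat.le_mul_of_pos_right _ hq
  have hqD : q ≤ p * q := Nat.le_mul_of_pos_left _ hp
  have hDa : p * q ≤ p * q * a := Nat.le_mul_of_pos_right _ (by omega)
  have hDa6 : 6 ≤ p * q * a := ha.trans (Nat.le_mul_of_pos_left _ hD)
  have hsplit : p * q * (p + q) * a = p * q * a * p + p * q * a * q := by ring
  have hDap : p * q * a ≤ p * q * a * p := Nat.le_mul_of_pos_right _ hp
  have hDaq : p * q * a ≤ p * q * a * q := Nat.le_mul_of_pos_right _ hq
  have htq : t * q = p * q * a * q + q := by rw [htdef]; ring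
  have htp : t * p = p * q * a * p + p := by rw [htdef]; ring
  have hcop : ∀ r, r ∣ p * q → Nat.Coprime N r := by
    rintro r ⟨c, hc⟩
    have : N = r * (c * (p + q) * a) + 1 := by rw [hNdef, hc]; ring
    rw [this, Nat.coprime_mul_left_add_left]
    exact Nat.coprime_one_left r
  have hNN : Nat.Coprime N N' := by
    rw [hNdef', Nat.coprime_self_add_right]
    exact hcop _ dvd_rfl
  have hNp : Nat.Coprime N' p := by
    rw [hNdef', Nat.coprime_add_mul_left_left]
    exact hcop p (dvd_mul_right p q)
  have hmul : 12 * N ≤ N * N' := by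
    rw [mul_comm]
    exact Nat.mul_le_mul_left N (by omega)
  have key := le_idealOrder_gen (n := n) (t := t) (vx := N - t * q) (vy := N' - t * p) hp hq hpq
    (by omega) (by omega) hNN (hcop q (dvd_mul_left q p)) hNp (by omega) (by omega) (by omega)
    (by omega) (by omega) (by omega) (by omega) (by omega) hL
  have h2 : 2 * (N * N) ≤ 2 * (N * N') := by
    have := Nat.mul_le_mul_left N (show N ≤ N' by omega)
    omega
  have h3 : 2 * (N * N) = 2 * (p * q * (p + q) * a) ^ 2 + 4 * (p * q * (p + q) * a) + 2 := by
    rw [hNdef]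
    ring
  -- The linear surplus in 2N² pays for the loss t.
  omega

theorem eventually_le_idealOrder (hp : 0 < p) (hq : 0 < q) (hpq : Nat.Coprime p q) :
    ∃ C : ℝ, ∀ᶠ n : ℕ in atTop, ∀ L : ℕ → CoeffRing 𝕜 n,
      IsSaddleValues p q (genP 𝕜 n) (genQ 𝕜 n) L →
        2 * (n : ℝ) ^ 2 + -C * n ≤ (idealOrder L : ℝ) := by
  obtain ⟨T, hT⟩ : ∃ T, T = p * q * (p + q) := ⟨_, rfl⟩
  have hT0 : 0 < T := hT ▸ Nat.mul_pos (Nat.mul_pos hp hq) (by omega)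
  obtain ⟨c, hc⟩ : ∃ c, c = T + p * q + 2 := ⟨_, rfl⟩
  refine ⟨4 * c, ?_⟩
  filter_upwards [eventually_ge_atTop (T * 6 + p * q + 2)] with n hn L hL
  -- The largest a allowed by the degree bound; rounding costs less than T, so Ta ≥ n - c.
  obtain ⟨a, ha⟩ : ∃ a, a = (n - (p * q + 2)) / T := ⟨_, rfl⟩
  have ha6 : 6 ≤ a := by
    rw [ha, Nat.le_div_iff_mul_le hT0, mul_comm]
    omega
  have hle : T * a ≤ n - (p * q + 2) := ha ▸ Nat.mul_div_le _ _
  have hlt : n - (p * q + 2) < T * a + T := by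
    rw [ha]
    exact Nat.lt_mul_div_succ _ hT0
  have key := le_idealOrder_param hp hq hpq ha6 (by rw [← hT]; omega) hL
  rw [← hT] at key
  have hnc : n ≤ T * a + c := by omega
  have hnc' : (n : ℝ) ≤ (T * a : ℕ) + c := by exact_mod_cast hnc
  have hcn : (c : ℝ) ≤ n := by exact_mod_cast (by omega : c ≤ n)
  have key' : 2 * ((T * a : ℕ) : ℝ) ^ 2 ≤ idealOrder L := by exact_mod_cast key
  have hsq : ((n : ℝ) - c) ^ 2 ≤ ((T * a : ℕ) : ℝ) ^ 2 :=
    pow_le_pow_left₀ (by linarith) (by linarith) 2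
  nlinarith [sq_nonneg (c : ℝ)]

end Bound

end

end ResonantSaddle


theorem theorem4 (𝕜 : Type*) [RCLike 𝕜] (p q : ℕ) (hp : 0 < p) (hq : 0 < q)
    (hpq : Nat.Coprime p q) :
    (∃ E : ℕ → ℝ, E =O[atTop] (fun n : ℕ => (n : ℝ)) ∧
      ∀ᶠ n : ℕ in atTop, ∀ L : ℕ → ResonantSaddle.CoeffRing 𝕜 n,
        ResonantSaddle.IsSaddleValues p q (ResonantSaddle.genP 𝕜 n) (ResonantSaddle.genQ 𝕜 n) L →
          3 / 2 * (n : ℝ) ^ 2 + E n ≤ (ResonantSaddle.idealOrder L : ℝ)) ∧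
    (p = 1 → ∃ E : ℕ → ℝ, E =O[atTop] (fun n : ℕ => (n : ℝ)) ∧
      ∀ᶠ n : ℕ in atTop, ∀ L : ℕ → ResonantSaddle.CoeffRing 𝕜 n,
        ResonantSaddle.IsSaddleValues p q (ResonantSaddle.genP 𝕜 n) (ResonantSaddle.genQ 𝕜 n) L →
          2 * (n : ℝ) ^ 2 + E n ≤ (ResonantSaddle.idealOrder L : ℝ)) := by
  obtain ⟨C, hC⟩ := ResonantSaddle.eventually_le_idealOrder (𝕜 := 𝕜) hp hq hpq
  have hO : (fun n : ℕ => -C * (n : ℝ)) =O[atTop] (fun n : ℕ => (n : ℝ)) :=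
    Asymptotics.isBigO_const_mul_self _ _ _
  refine ⟨⟨_, hO, ?_⟩, fun _ => ⟨_, hO, hC⟩⟩
  filter_upwards [hC] with n hn L hL
  -- The constant 2 was obtained for every coprime pair, so 3/2 follows a fortiori.
  nlinarith [hn L hL, sq_nonneg (n : ℝ)]
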